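/- Let $R$ be an (associative, unital) ring of characteristic $0$ whose additive group is torsion-free; equivalently, $R \neq 0$ and the canonical map $R \to \mathbb{C}\otimes_{\mathbb{Z}} R$ is injective. Let $a, b \in R$ satisfy $a^2 = b^2 = 0$ and let $\alpha = 1+a$ and $\beta = 1+b$, which are units of $R$. A pair $(u,v)$ of units is called a free pair if $u$ and $v$ freely generate a free group of rank two. An eigenvalue of an element $x$ of a complex algebra $A$ is an eigenvalue of the linear endomorphism $y \mapsto xy$ of $A$. 1. For all positive integers $m$ and $n$, $(\alpha^m, \beta^n)$ is a free pair if and only if $(\alpha, \beta^{mn})$ is a free pair. 2. If $ab$ is not nilpotent, then $(\alpha, \beta^m)$ is a free pair for some positive integer $m$. 3. The element $ab$ is nilpotent if and only if the group $\langle \alpha, \beta\rangle$ is nilpotent. Moreover, let $A$ be the complex algebra $\mathbb{C}\otimes_{\mathbb{Z}} R$ or any other complex algebra that contains $R$ as a (unital) subring. If $ab$, as an element of $A$, is algebraic over $\mathbb{C}$, then $\langle \alpha,\beta\rangle$ is nilpotent if and only if $0$ is the only eigenvalue of $ab$ in $A$. -/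

import Mathlib

open scoped TensorProduct

/-- `(u, v)` is a free pair: `u` and `v` freely generate a (non-abelian) free group of rank two,
that is, the homomorphism from the free group on two letters to `G` that sends the letters to
`u` and `v` is injective. -/
def IsFreePair {G : Type*} [Group G] (u v : G) : Prop :=
  Function.Injective (FreeGroup.lift ![u, v] : FreeGroup (Fin 2) →* G)

/-- `μ` is an eigenvalue of the element `x` of a complex algebra `A`: it is an eigenvalue of the
linear endomorphism `y ↦ x * y` of the vector space `A`. -/
def IsEigenvalueOf {A : Type*} [Ring A] [Algebra ℂ A] (x : A) (μ : ℂ) : Prop :=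
  Module.End.HasEigenvalue (LinearMap.mulLeft ℂ x : Module.End ℂ A) μ

/-- `0` is an eigenvalue of `x`, and it is the only one. -/
def ZeroIsOnlyEigenvalue {A : Type*} [Ring A] [Algebra ℂ A] (x : A) : Prop :=
  ∀ μ : ℂ, IsEigenvalueOf x μ ↔ μ = 0

/-- An element of a ring `R`, regarded as an element of the complex algebra `ℂ ⊗ R`. -/
noncomputable def complexify {R : Type*} [Ring R] (x : R) : ℂ ⊗[ℤ] R :=
  (1 : ℂ) ⊗ₜ[ℤ] x

/-! Powers are linear, `α ^ k = 1 + k • a`, and only alternating words in `a`, `b` survive. Scaling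
`(a, b)` to `(m a, n b)` or to `(a, m n b)` gives an alternating word the same coefficient if its
end letters differ, and one off by the factor `m` if they agree. So a relation for one pair makes
the other pair's value `y` satisfy `c (y - 1) d = 0` for all `c, d ∈ {a, b}` (`mul_lift_mul_eq`).
Products of three such `y - 1` vanish, which kills triple commutators; a nontrivial normal subgroup
of a free group cannot have this (`not_injective_of_mul_mul_eq_zero`).

If `ab` is not nilpotent, some `l ≠ 0` in `ℂ` is a root of every integral polynomial that kills
`ab`. Sandwiched word values are integral polynomials in `ab`, and the same polynomials at `l` give
matrix entries (`exists_entries_aeval`). A relation in `R` thus passes to unipotent matrices, which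
are free by ping-pong once `‖m l‖ ≥ 4`.

If `ab` is nilpotent, long words vanish and word length yields a central series; otherwise the free
pair obstructs nilpotency. Roots of the minimal polynomial are eigenvalues, which gives the spectral
criterion. -/

/-! ### Ping-pong for unipotent matrices and free groups of rank two -/

/-- The upper unitriangular matrix with off-diagonal entry `t`. -/
def upperUnipotent (t : ℂ) : Matrix.SpecialLinearGroup (Fin 2) ℂ :=
  ⟨!![1, t; 0, 1], by simp⟩

/-- The lower unitriangular matrix with off-diagonal entry `t`. -/
def lowerUnipotent (t : ℂ) : Matrix.SpecialLinearGroup (Fin 2) ℂ :=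
  ⟨!![1, 0; t, 1], by simp⟩

theorem upperUnipotent_add (s t : ℂ) :
    upperUnipotent (s + t) = upperUnipotent s * upperUnipotent t := by
  refine Subtype.ext ?_
  change !![1, s + t; 0, 1] = !![1, s; 0, 1] * !![1, t; 0, 1]
  simp [add_comm]

theorem lowerUnipotent_add (s t : ℂ) :
    lowerUnipotent (s + t) = lowerUnipotent s * lowerUnipotent t := by
  refine Subtype.ext ?_
  change !![1, 0; s + t, 1] = !![1, 0; s, 1] * !![1, 0; t, 1]
  simp

theorem upperUnipotent_zpow (t : ℂ) (k : ℤ) :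
    upperUnipotent t ^ k = upperUnipotent (k * t) := by
  let f : Multiplicative ℂ →* Matrix.SpecialLinearGroup (Fin 2) ℂ :=
    MonoidHom.mk' (fun s => upperUnipotent s.toAdd) fun s t => upperUnipotent_add _ _
  have h := (map_zpow f (Multiplicative.ofAdd t) k).symm
  rw [← ofAdd_zsmul, zsmul_eq_mul] at h
  exact h

theorem lowerUnipotent_zpow (t : ℂ) (k : ℤ) :
    lowerUnipotent t ^ k = lowerUnipotent (k * t) := by
  let f : Multiplicative ℂ →* Matrix.SpecialLinearGroup (Fin 2) ℂ :=
    MonoidHom.mk' (fun s => lowerUnipotent s.toAdd) fun s t => lowerUnipotent_add _ _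
  have h := (map_zpow f (Multiplicative.ofAdd t) k).symm
  rw [← ofAdd_zsmul, zsmul_eq_mul] at h
  exact h

theorem one_le_norm_intCast {k : ℤ} (hk : k ≠ 0) : 1 ≤ ‖(k : ℂ)‖ := by
  rw [Complex.norm_intCast]
  exact_mod_cast Int.one_le_abs hk

/-- The ping-pong lemma for a free group on two generators, with the nonzero powers of the two
generators exchanging two disjoint sets. -/
theorem isFreePair_of_ping_pong {G V : Type*} [Group G] [MulAction G V] (u v : G) (X Y : Set V)
    (hX : X.Nonempty) (hY : Y.Nonempty) (hXY : Disjoint X Y)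
    (hu : ∀ k : ℤ, k ≠ 0 → ∀ z ∈ Y, u ^ k • z ∈ X)
    (hv : ∀ k : ℤ, k ≠ 0 → ∀ z ∈ X, v ^ k • z ∈ Y) : IsFreePair u v := by
  have key : FreeGroup.lift ![u, v] =
      (Monoid.CoprodI.lift fun i => FreeGroup.lift fun _ : Unit => ![u, v] i).comp
        (freeGroupEquivCoprodI (ι := Fin 2)).toMonoidHom := by
    ext i
    simp
  have hpow : ∀ i (h : FreeGroup Unit), h ≠ 1 → ∃ k : ℤ, k ≠ 0 ∧
      FreeGroup.lift (fun _ : Unit => ![u, v] i) h = ![u, v] i ^ k := by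
    intro i
    refine FreeGroup.freeGroupUnitEquivInt.forall_congr_left.mpr fun k hk => ⟨k, ?_, ?_⟩
    · rintro rfl
      exact hk (by simp [FreeGroup.freeGroupUnitEquivInt])
    · change FreeGroup.lift _ (FreeGroup.of () ^ k) = _
      simp
  unfold IsFreePair
  rw [key, MonoidHom.coe_comp]
  refine Function.Injective.comp ?_ (MulEquiv.injective freeGroupEquivCoprodI)
  -- With only two factors, ping-pong needs a factor with at least three elements; an infinite
  -- cyclic one qualifies.
  refine Monoid.CoprodI.lift_injective_of_ping_pong _ (Or.inr ⟨0, ?_⟩) ![X, Y] ?_ ?_ ?_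
  · rw [FreeGroup.freeGroupUnitEquivInt.cardinal_eq, Cardinal.mk_denumerable]
    exact Cardinal.natCast_le_aleph0
  · simp [Fin.forall_fin_two, hX, hY]
  · intro i j hij
    fin_cases i <;> fin_cases j <;> simp_all [Function.onFun, hXY.symm]
  · intro i j hij h hh
    obtain ⟨k, hk, e⟩ := hpow i h hh
    simp only [e]
    rintro _ ⟨z, hz, rfl⟩
    fin_cases i <;> fin_cases j
    · exact absurd rfl hij
    · exact hu k hk z hz
    · exact hv k hk z hz
    · exact absurd rfl hij

theorem IsFreePair.of_map {G H : Type*} [Group G] [Group H] (f : G →* H) {u v : G}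
    (h : IsFreePair (f u) (f v)) : IsFreePair u v := by
  have e : FreeGroup.lift ![f u, f v] = f.comp (FreeGroup.lift ![u, v]) := by
    ext i
    fin_cases i <;> simp
  unfold IsFreePair at h
  rw [e, MonoidHom.coe_comp] at h
  exact h.of_comp

/-- The lines of slope modulus below and above `2` play ping-pong. The bound `4` leaves `4 - 2 = 2`
after the triangle inequality. -/
theorem isFreePair_upperUnipotent_lowerUnipotent {μ : ℂ} (hμ : 4 ≤ ‖μ‖) :
    IsFreePair (upperUnipotent 1) (lowerUnipotent μ) := by
  refine IsFreePair.of_map Matrix.SpecialLinearGroup.toLin' ?_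
  refine isFreePair_of_ping_pong (V := Fin 2 → ℂ) _ _
    {z | ‖z 1‖ < 2 * ‖z 0‖} {z | 2 * ‖z 0‖ < ‖z 1‖} ⟨![1, 0], by simp⟩ ⟨![0, 1], by simp⟩ ?_ ?_ ?_
  · rw [Set.disjoint_left]
    intro z h1 h2
    exact lt_asymm (show ‖z 1‖ < 2 * ‖z 0‖ from h1) h2
  · intro k hk z hz
    rw [← map_zpow, upperUnipotent_zpow]
    have e0 : ((Matrix.SpecialLinearGroup.toLin' (upperUnipotent (k * 1))) z) =
        ![z 0 + k * z 1, z 1] := by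
      change (!![1, k * 1; 0, 1] : Matrix (Fin 2) (Fin 2) ℂ).mulVec z = _
      ext i
      fin_cases i <;> simp [Matrix.mulVec, dotProduct]
    change (Matrix.SpecialLinearGroup.toLin' (upperUnipotent (k * 1))) z ∈ _
    rw [e0]
    simp only [Set.mem_ofPred_eq, Matrix.cons_val_zero, Matrix.cons_val_one] at hz ⊢
    have h1 : ‖(k : ℂ) * z 1‖ ≤ ‖z 0 + k * z 1‖ + ‖z 0‖ := by
      simpa using norm_sub_le (z 0 + k * z 1) (z 0)
    have h2 : ‖z 1‖ ≤ ‖(k : ℂ) * z 1‖ := by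
      rw [norm_mul]
      exact le_mul_of_one_le_left (norm_nonneg _) (one_le_norm_intCast hk)
    linarith
  · intro k hk z hz
    rw [← map_zpow, lowerUnipotent_zpow]
    have e0 : ((Matrix.SpecialLinearGroup.toLin' (lowerUnipotent (k * μ))) z) =
        ![z 0, k * μ * z 0 + z 1] := by
      change (!![1, 0; k * μ, 1] : Matrix (Fin 2) (Fin 2) ℂ).mulVec z = _
      ext i
      fin_cases i <;> simp [Matrix.mulVec, dotProduct]
    change (Matrix.SpecialLinearGroup.toLin' (lowerUnipotent (k * μ))) z ∈ _
    rw [e0]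
    simp only [Set.mem_ofPred_eq, Matrix.cons_val_zero, Matrix.cons_val_one] at hz ⊢
    have h1 : ‖(k : ℂ) * μ * z 0‖ ≤ ‖k * μ * z 0 + z 1‖ + ‖z 1‖ := by
      simpa using norm_sub_le (k * μ * z 0 + z 1) (z 1)
    have h2 : 4 * ‖z 0‖ ≤ ‖(k : ℂ) * μ * z 0‖ := by
      rw [norm_mul, norm_mul]
      have := one_le_norm_intCast hk
      gcongr
      nlinarith
    linarith

/-! ### Conjugates and nilpotency in the free group of rank two -/

theorem freeGroup_induction_zpow_mul {ι : Type*} {P : FreeGroup ι → Prop} (one : P 1)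
    (mul : ∀ (i : ι) (k : ℤ) (w : FreeGroup ι), P w → P (FreeGroup.of i ^ k * w))
    (w : FreeGroup ι) : P w := by
  have hw : w ∈ Subgroup.closure (Set.range (FreeGroup.of : ι → FreeGroup ι)) := by
    rw [FreeGroup.closure_range_of]
    trivial
  induction hw using Subgroup.closure_induction_left with
  | one => exact one
  | mul_left x hx y _ h =>
    obtain ⟨i, rfl⟩ := hx
    simpa using mul i 1 y h
  | inv_mul_cancel x hx y _ h =>
    obtain ⟨i, rfl⟩ := hx
    simpa using mul i (-1) y h

/-- Single entries of the two relations are multiples of `r ^ 2` and `q ^ 2`; once these vanish,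
another entry becomes `(p - s) ^ 2` up to sign. -/
theorem eq_diagonal_of_commute_conj {M : Matrix (Fin 2) (Fin 2) ℂ}
    (h0 : M * (!![1, 1; 0, 1] * M * !![1, -1; 0, 1]) = !![1, 1; 0, 1] * M * !![1, -1; 0, 1] * M)
    (h1 : M * (!![1, 0; 4, 1] * M * !![1, 0; -4, 1]) = !![1, 0; 4, 1] * M * !![1, 0; -4, 1] * M) :
    ∃ p, M = !![p, 0; 0, p] := by
  rw [Matrix.eta_fin_two M] at h0 h1 ⊢
  generalize M 0 0 = p, M 0 1 = q, M 1 0 = r, M 1 1 = s at h0 h1 ⊢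
  have a0 := congrFun (congrFun h0 1) 0
  have a1 := congrFun (congrFun h1 0) 1
  have a2 := congrFun (congrFun h0 0) 1
  simp at a0 a1 a2
  have hr : r = 0 := by
    have : r ^ 2 = 0 := by linear_combination a0 / 2
    simpa using this
  have hq : q = 0 := by
    have : q ^ 2 = 0 := by linear_combination a1 / 8
    simpa using this
  have hps : p = s := by
    rw [hr, hq] at a2
    have : (p - s) ^ 2 = 0 := by linear_combination -a2
    exact sub_eq_zero.mp (by simpa using this)
  exact ⟨p, by rw [hr, hq, hps]⟩

/-- In a free group of rank two, a nontrivial element fails to commute with one of its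
conjugates. -/
theorem freeGroup_exists_not_commute_conj {w : FreeGroup (Fin 2)} (hw : w ≠ 1) :
    ∃ g : FreeGroup (Fin 2), ¬ Commute w (g * w * g⁻¹) := by
  by_contra! hcomm
  have hinj : IsFreePair (upperUnipotent 1) (lowerUnipotent 4) :=
    isFreePair_upperUnipotent_lowerUnipotent (by norm_num)
  obtain ⟨φ, hφ⟩ : ∃ φ : FreeGroup (Fin 2) →* Matrix.SpecialLinearGroup (Fin 2) ℂ,
    φ = FreeGroup.lift ![upperUnipotent 1, lowerUnipotent 4] := ⟨_, rfl⟩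
  rw [IsFreePair, ← hφ] at hinj
  have e0 : φ (FreeGroup.of 0) = upperUnipotent 1 := by simp [hφ]
  have e1 : φ (FreeGroup.of 1) = lowerUnipotent 4 := by simp [hφ]
  have i0 : (upperUnipotent 1)⁻¹ = upperUnipotent (-1) := by
    simpa using upperUnipotent_zpow 1 (-1)
  have i1 : (lowerUnipotent 4)⁻¹ = lowerUnipotent (-4) := by
    simpa using lowerUnipotent_zpow 4 (-1)
  have h0 : φ w * (upperUnipotent 1 * φ w * upperUnipotent (-1)) =
      upperUnipotent 1 * φ w * upperUnipotent (-1) * φ w := by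
    rw [← i0, ← e0, ← map_inv, ← map_mul, ← map_mul, ← map_mul, ← map_mul, (hcomm _).eq]
  have h1 : φ w * (lowerUnipotent 4 * φ w * lowerUnipotent (-4)) =
      lowerUnipotent 4 * φ w * lowerUnipotent (-4) * φ w := by
    rw [← i1, ← e1, ← map_inv, ← map_mul, ← map_mul, ← map_mul, ← map_mul, (hcomm _).eq]
  have hdiag := eq_diagonal_of_commute_conj
    (M := (φ w).1) (congrArg Subtype.val h0) (congrArg Subtype.val h1)
  -- A scalar matrix of determinant one squares to the identity, and free groups are torsion-free.
  have hsq : w ^ 2 = 1 := by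
    have hdet := (φ w).det_coe
    obtain ⟨p, hp⟩ := hdiag
    apply hinj
    rw [map_one, map_pow, pow_two]
    refine Subtype.ext ?_
    change (φ w).1 * (φ w).1 = 1
    change (φ w).1.det = 1 at hdet
    rw [hp] at hdet ⊢
    rw [Matrix.det_fin_two_of] at hdet
    simp only [mul_zero, sub_zero] at hdet
    simp [hdet, Matrix.one_fin_two]
  exact hw (by simpa using hsq)

theorem freeGroup_not_isNilpotent : ¬ Group.IsNilpotent (FreeGroup (Fin 2)) := by
  intro h
  obtain ⟨z, hz⟩ := Subgroup.ne_bot_iff_exists_ne_one.mp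
    (Group.IsNilpotent.center_ne_bot (G := FreeGroup (Fin 2)))
  obtain ⟨g, hg⟩ := freeGroup_exists_not_commute_conj (w := z) (by simpa using hz)
  exact hg ((Subgroup.mem_center_iff.mp z.2 _).symm)

/-- The free group embeds in `H`; its trivial kernel is central, so nilpotency would pull back. -/
theorem IsFreePair.not_isNilpotent {G : Type*} [Group G] {u v : G} (h : IsFreePair u v)
    {H : Subgroup G} (hu : u ∈ H) (hv : v ∈ H) : ¬ Group.IsNilpotent H := by
  intro hn
  refine freeGroup_not_isNilpotent ?_
  have h' : IsFreePair (⟨u, hu⟩ : H) ⟨v, hv⟩ := IsFreePair.of_map H.subtype h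
  exact Subgroup.isNilpotent_of_ker_le_center (FreeGroup.lift _)
    (((MonoidHom.ker_eq_bot_iff _).mpr h').trans_le bot_le)

/-! ### Units `1 + a` with `a ^ 2 = 0` -/

open scoped commutatorElement

section SquareZero

variable {R : Type*} [Ring R]

theorem val_zpow_of_sq_eq_zero {a : R} (ha : a * a = 0) {α : Rˣ} (hα : (α : R) = 1 + a) (k : ℤ) :
    ((α ^ k : Rˣ) : R) = 1 + k • a := by
  have hinv : ((α⁻¹ : Rˣ) : R) = 1 - a := by
    refine Units.inv_eq_of_mul_eq_one_right ?_
    rw [hα, add_mul, mul_sub, mul_sub, ha]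
    simp
  induction k using Int.induction_on with
  | zero => simp
  | succ n ih =>
    rw [zpow_add_one, Units.val_mul, ih, hα, add_mul, mul_add, smul_mul_assoc, mul_add, ha]
    simp only [mul_one, one_mul, add_zero, add_smul, one_smul]
    abel
  | pred n ih =>
    rw [zpow_sub_one, Units.val_mul, ih, hinv, add_mul, mul_sub, smul_mul_assoc, mul_sub, ha]
    simp only [mul_one, one_mul, sub_zero, sub_smul, one_smul]
    abel

/-- Left multiplication by a power of the unit `1 + m • a` with `a ^ 2 = 0`. -/
theorem val_pow_zpow_mul {a : R} (ha : a * a = 0) {α : Rˣ} (hα : (α : R) = 1 + a) (m : ℕ) (k : ℤ)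
    (x : Rˣ) : (((α ^ m) ^ k * x : Rˣ) : R) = x + (m * k : ℤ) • (a * x) := by
  rw [← zpow_natCast, ← zpow_mul, Units.val_mul, val_zpow_of_sq_eq_zero ha hα, add_mul, one_mul,
    smul_mul_assoc]

variable {a b : R} {α β : Rˣ}

/-- The values of one word at `(α ^ m, β ^ n)` and at `(α, β ^ (m * n))` agree after multiplication
by `a` or `b` on each side, up to integer factors. -/
theorem mul_lift_mul_eq (ha : a * a = 0) (hb : b * b = 0) (hα : (α : R) = 1 + a)
    (hβ : (β : R) = 1 + b) (m n : ℕ) (w : FreeGroup (Fin 2)) (x y : Rˣ)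
    (hx : x = FreeGroup.lift ![α ^ m, β ^ n] w) (hy : y = FreeGroup.lift ![α, β ^ (m * n)] w) :
    a * y * a = (m : ℤ) • (a * x * a) ∧ (m : ℤ) • (b * y * b) = b * x * b ∧
      a * y * b = a * x * b ∧ b * y * a = b * x * a := by
  induction w using freeGroup_induction_zpow_mul generalizing x y with
  | one => simp [hx, hy, ha, hb]
  | mul i k w ih =>
    obtain ⟨h1, h2, h3, h4⟩ := ih _ _ rfl rfl
    rw [map_mul, map_zpow, FreeGroup.lift_apply_of] at hx hy
    generalize FreeGroup.lift ![α ^ m, β ^ n] w = x' at *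
    generalize FreeGroup.lift ![α, β ^ (m * n)] w = y' at *
    fin_cases i
    · change x = (α ^ m) ^ k * x' at hx
      change y = α ^ k * y' at hy
      have ex := val_pow_zpow_mul ha hα m k x'
      have ey := val_pow_zpow_mul ha hα 1 k y'
      rw [← hx] at ex
      rw [pow_one, ← hy] at ey
      have haa : ∀ z, a * (a * z) = 0 := fun z => by rw [← mul_assoc, ha, zero_mul]
      simp only [mul_assoc] at h1 h2 h3 h4
      simp only [ex, ey, mul_add, add_mul, mul_smul_comm, smul_mul_assoc, mul_assoc, haa, smul_zero,
        add_zero, smul_add, h1, h2, h3, h4, smul_smul]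
      simp [mul_comm]
    · change x = (β ^ n) ^ k * x' at hx
      change y = (β ^ (m * n)) ^ k * y' at hy
      have ex := val_pow_zpow_mul hb hβ n k x'
      have ey := val_pow_zpow_mul hb hβ (m * n) k y'
      rw [← hx] at ex
      rw [← hy] at ey
      have hbb : ∀ z, b * (b * z) = 0 := fun z => by rw [← mul_assoc, hb, zero_mul]
      simp only [mul_assoc] at h1 h2 h3 h4
      simp only [ex, ey, mul_add, add_mul, mul_smul_comm, smul_mul_assoc, mul_assoc, hbb, smul_zero,
        add_zero, smul_add, h1, ← h2, h3, h4, smul_smul]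
      simp [mul_comm, mul_left_comm, mul_assoc]

/-- `x - 1` lies in `Ra + Rb` and in `aR + bR` for `x` in the group generated by `α` and `β`. -/
theorem exists_sub_one_eq (ha : a * a = 0) (hb : b * b = 0) (hα : (α : R) = 1 + a)
    (hβ : (β : R) = 1 + b) (m n : ℕ) (w : FreeGroup (Fin 2)) :
    (∃ p q : R, (FreeGroup.lift ![α ^ m, β ^ n] w : R) - 1 = p * a + q * b) ∧
      ∃ p q : R, (FreeGroup.lift ![α ^ m, β ^ n] w : R) - 1 = a * p + b * q := by
  induction w using freeGroup_induction_zpow_mul with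
  | one => exact ⟨⟨0, 0, by simp⟩, ⟨0, 0, by simp⟩⟩
  | mul i k w ih =>
    obtain ⟨⟨p, q, h⟩, ⟨p', q', h'⟩⟩ := ih
    rw [map_mul, map_zpow, FreeGroup.lift_apply_of]
    generalize FreeGroup.lift ![α ^ m, β ^ n] w = x at *
    fin_cases i
    · change (∃ p q : R, (((α ^ m) ^ k * x : Rˣ) : R) - 1 = _) ∧
        ∃ p q : R, (((α ^ m) ^ k * x : Rˣ) : R) - 1 = _
      rw [val_pow_zpow_mul ha hα]
      refine ⟨⟨p + (m * k : ℤ) • (1 + a * p), q + (m * k : ℤ) • (a * q), ?_⟩,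
        ⟨p' + (m * k : ℤ) • (x : R), q', ?_⟩⟩
      · rw [eq_add_of_sub_eq h]
        simp only [mul_add, add_mul, smul_add, smul_mul_assoc, mul_assoc, mul_one, one_mul]
        abel
      · rw [add_sub_right_comm, h']
        simp only [mul_add, mul_smul_comm]
        abel
    · change (∃ p q : R, (((β ^ n) ^ k * x : Rˣ) : R) - 1 = _) ∧
        ∃ p q : R, (((β ^ n) ^ k * x : Rˣ) : R) - 1 = _
      rw [val_pow_zpow_mul hb hβ]
      refine ⟨⟨p + (n * k : ℤ) • (b * p), q + (n * k : ℤ) • (1 + b * q), ?_⟩,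
        ⟨p', q' + (n * k : ℤ) • (x : R), ?_⟩⟩
      · rw [eq_add_of_sub_eq h]
        simp only [mul_add, add_mul, smul_add, smul_mul_assoc, mul_assoc, mul_one, one_mul]
        abel
      · rw [add_sub_right_comm, h']
        simp only [mul_add, mul_smul_comm]
        abel

/-- A nontrivial normal subgroup of the free group of rank two contains a nontrivial triple
commutator. -/
theorem exists_not_commute_commutator {N : Subgroup (FreeGroup (Fin 2))} [N.Normal] (hN : N ≠ ⊥) :
    ∃ u ∈ N, ∃ v ∈ N, ∃ w ∈ N, ¬ Commute ⁅u, v⁆ w := by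
  obtain ⟨u, hu⟩ := Subgroup.ne_bot_iff_exists_ne_one.mp hN
  have hu1 : (u : FreeGroup (Fin 2)) ≠ 1 := by simpa using hu
  obtain ⟨g, hg⟩ := freeGroup_exists_not_commute_conj hu1
  obtain ⟨h, hh⟩ := freeGroup_exists_not_commute_conj (mt commutatorElement_eq_one_iff_commute.mp hg)
  have hv := Subgroup.Normal.conj_mem ‹N.Normal› u u.2 g
  have huv : ⁅(u : FreeGroup (Fin 2)), g * u * g⁻¹⁆ ∈ N := by
    rw [commutatorElement_def]
    exact mul_mem (mul_mem (mul_mem u.2 hv) (inv_mem u.2)) (inv_mem hv)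
  exact ⟨u, u.2, _, hv, _, Subgroup.Normal.conj_mem ‹N.Normal› _ huv h, hh⟩

/-- If products of three elements of the form `u - 1` vanish on a nontrivial normal subgroup, the
homomorphism is not injective. -/
theorem not_injective_of_mul_mul_eq_zero (f : FreeGroup (Fin 2) →* Rˣ)
    {N : Subgroup (FreeGroup (Fin 2))} [N.Normal] (hN : N ≠ ⊥)
    (h : ∀ u ∈ N, ∀ v ∈ N, ∀ w ∈ N, ((f u : R) - 1) * ((f v : R) - 1) * ((f w : R) - 1) = 0) :
    ¬ Function.Injective f := by
  intro hf
  obtain ⟨u, hu, v, hv, w, hw, hc⟩ := exists_not_commute_commutator hN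
  refine hc ?_
  -- Here `⁅u, v⁆ - 1 = (uv - vu)(vu)⁻¹`, and replacing `(vu)⁻¹` by `1` costs only vanishing triple
  -- products.
  have key : (f ⁅u, v⁆ : R) - 1 =
      ((f u : R) - 1) * ((f v : R) - 1) - ((f v : R) - 1) * ((f u : R) - 1) := by
    have h1 : ((f u * f v : Rˣ) : R) * ((f (v * u)⁻¹ : Rˣ) : R) = (f ⁅u, v⁆ : R) := by
      rw [← Units.val_mul, ← map_mul, ← map_mul, commutatorElement_def, mul_inv_rev]
      simp only [mul_assoc]
    have h2 : ((f v * f u : Rˣ) : R) * ((f (v * u)⁻¹ : Rˣ) : R) = 1 := by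
      rw [← Units.val_mul, ← map_mul, ← map_mul]
      simp
    have h3 := h u hu v hv _ (inv_mem (mul_mem hv hu))
    have h4 := h v hv u hu _ (inv_mem (mul_mem hv hu))
    have h5 : ((f u * f v : Rˣ) : R) - (f v * f u : Rˣ) =
        ((f u : R) - 1) * ((f v : R) - 1) - ((f v : R) - 1) * ((f u : R) - 1) := by
      simp only [Units.val_mul]
      noncomm_ring
    calc (f ⁅u, v⁆ : R) - 1 = (((f u * f v : Rˣ) : R) - (f v * f u : Rˣ)) * (f (v * u)⁻¹ : Rˣ) := by
          rw [sub_mul, h1, h2]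
      _ = ((f u : R) - 1) * ((f v : R) - 1) - ((f v : R) - 1) * ((f u : R) - 1) +
          ((f u : R) - 1) * ((f v : R) - 1) * ((f (v * u)⁻¹ : R) - 1) -
          ((f v : R) - 1) * ((f u : R) - 1) * ((f (v * u)⁻¹ : R) - 1) := by
        rw [h5]
        noncomm_ring
      _ = _ := by rw [h3, h4, add_zero, sub_zero]
  have hl := h u hu v hv w hw
  have hl' := h v hv u hu w hw
  have hr := h w hw u hu v hv
  have hr' := h w hw v hv u hu
  apply hf
  rw [map_mul, map_mul]
  refine Units.ext ?_
  rw [Units.val_mul, Units.val_mul, eq_add_of_sub_eq key]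
  rw [← sub_eq_zero]
  calc _ = ((f u : R) - 1) * ((f v : R) - 1) * ((f w : R) - 1) -
        ((f v : R) - 1) * ((f u : R) - 1) * ((f w : R) - 1) -
        (((f w : R) - 1) * (((f u : R) - 1) * ((f v : R) - 1)) -
          ((f w : R) - 1) * (((f v : R) - 1) * ((f u : R) - 1))) := by noncomm_ring
    _ = 0 := by rw [← mul_assoc, ← mul_assoc, hl, hl', hr, hr']; simp

theorem mul_mul_eq_zero_of_forall {y₁ y₂ y₃ p q p' q' : R} (h₁ : y₁ = p * a + q * b)
    (h₃ : y₃ = a * p' + b * q') (haa : a * y₂ * a = 0) (hab : a * y₂ * b = 0)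
    (hba : b * y₂ * a = 0) (hbb : b * y₂ * b = 0) : y₁ * y₂ * y₃ = 0 := by
  calc y₁ * y₂ * y₃ = p * (a * y₂ * a) * p' + p * (a * y₂ * b) * q' + q * (b * y₂ * a) * p' +
        q * (b * y₂ * b) * q' := by rw [h₁, h₃]; noncomm_ring
    _ = 0 := by simp [haa, hab, hba, hbb]

theorem isFreePair_pow_pow_iff [IsAddTorsionFree R] (ha : a * a = 0) (hb : b * b = 0)
    (hα : (α : R) = 1 + a) (hβ : (β : R) = 1 + b) {m n : ℕ} (hm : 0 < m) :
    IsFreePair (α ^ m) (β ^ n) ↔ IsFreePair α (β ^ (m * n)) := by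
  have hm0 : (m : ℤ) ≠ 0 := by exact_mod_cast hm.ne'
  have hrel := fun w => mul_lift_mul_eq ha hb hα hβ m n w _ _ rfl rfl
  have hexp := exists_sub_one_eq ha hb hα hβ 1 (m * n)
  rw [pow_one] at hexp
  have hexp' := exists_sub_one_eq ha hb hα hβ m n
  unfold IsFreePair
  generalize (FreeGroup.lift ![α ^ m, β ^ n] : FreeGroup (Fin 2) →* Rˣ) = f at *
  generalize (FreeGroup.lift ![α, β ^ (m * n)] : FreeGroup (Fin 2) →* Rˣ) = g at *
  constructor <;> intro hinj <;> by_contra hnot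
  · rw [← MonoidHom.ker_eq_bot_iff] at hnot
    refine not_injective_of_mul_mul_eq_zero f hnot (fun u _ v hv w _ => ?_) hinj
    obtain ⟨h1, h2, h3, h4⟩ := hrel v
    rw [MonoidHom.mem_ker.mp hv] at h1 h2 h3 h4
    obtain ⟨p, q, hp⟩ := (hexp' u).1
    obtain ⟨p', q', hp'⟩ := (hexp' w).2
    simp only [Units.val_one, mul_one, ha, hb, smul_zero] at h1 h2 h3 h4
    -- Torsion-freeness cancels the factor `m`.
    have h1' := (smul_eq_zero_iff_right hm0).mp h1.symm
    apply mul_mul_eq_zero_of_forall hp hp' <;>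
      simp [mul_sub, sub_mul, ha, hb, h1', ← h2, ← h3, ← h4]
  · rw [← MonoidHom.ker_eq_bot_iff] at hnot
    refine not_injective_of_mul_mul_eq_zero g hnot (fun u _ v hv w _ => ?_) hinj
    obtain ⟨h1, h2, h3, h4⟩ := hrel v
    rw [MonoidHom.mem_ker.mp hv] at h1 h2 h3 h4
    obtain ⟨p, q, hp⟩ := (hexp u).1
    obtain ⟨p', q', hp'⟩ := (hexp w).2
    simp only [Units.val_one, mul_one, ha, hb, smul_zero] at h1 h2 h3 h4
    have h2' := (smul_eq_zero_iff_right hm0).mp h2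
    apply mul_mul_eq_zero_of_forall hp hp' <;>
      simp [mul_sub, sub_mul, ha, hb, h1, h2', h3, h4]

end SquareZero

/-! ### Specialization of words to complex matrices -/

section Specialization

open Polynomial

variable {R : Type*} [Ring R] {a b : R} {α β : Rˣ}

/-- The entries of the value of a word at `(1 + E₁₂, 1 + m l E₂₁)` are given by integral polynomials
in `l`; the value of the word at `(α, β ^ m)` is governed by the same polynomials in `a * b`. -/
theorem exists_entries_aeval (ha : a * a = 0) (hb : b * b = 0) (hα : (α : R) = 1 + a)
    (hβ : (β : R) = 1 + b) (m : ℕ) (l : ℂ) (w : FreeGroup (Fin 2))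
    (x : Rˣ) (M : Matrix.SpecialLinearGroup (Fin 2) ℂ) (hx : x = FreeGroup.lift ![α, β ^ m] w)
    (hM : M = FreeGroup.lift ![upperUnipotent 1, lowerUnipotent (m * l)] w) :
    ∃ p q r s : ℤ[X], M.1 = !![aeval l p, aeval l q; aeval l r, aeval l s] ∧
      a * b * x * a * b = aeval (a * b) (X ^ 2 * p) ∧ a * b * x * b = aeval (a * b) (X ^ 2 * q) ∧
      a * x * a * b = aeval (a * b) (X * r) ∧ a * x * b = aeval (a * b) (X * s) := by
  induction w using freeGroup_induction_zpow_mul generalizing x M with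
  | one =>
    refine ⟨1, 0, 0, 1, ?_, ?_, ?_, ?_, ?_⟩
    · simp [hM, Matrix.one_fin_two]
    · simp [hx, pow_two, mul_assoc]
    · simp [hx, mul_assoc, hb]
    · simp [hx, ha]
    · simp [hx]
  | mul i k w ih =>
    obtain ⟨p, q, r, s, h0, h1, h2, h3, h4⟩ := ih _ _ rfl rfl
    rw [map_mul, map_zpow, FreeGroup.lift_apply_of] at hx hM
    generalize FreeGroup.lift ![α, β ^ m] w = x' at *
    generalize FreeGroup.lift ![upperUnipotent 1, lowerUnipotent (m * l)] w = M' at *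
    fin_cases i
    · change x = α ^ k * x' at hx
      change M = upperUnipotent 1 ^ k * M' at hM
      have ex := val_pow_zpow_mul ha hα 1 k x'
      rw [pow_one, ← hx] at ex
      refine ⟨p + k • r, q + k • s, r, s, ?_, ?_, ?_, ?_, ?_⟩
      · rw [hM, upperUnipotent_zpow]
        change !![1, (k : ℂ) * 1; 0, 1] * M'.1 = _
        rw [h0]
        simp
      · rw [mul_add, map_add, ← h1, ex, mul_smul_comm, pow_two, mul_assoc X X r, map_smul,
          map_mul _ X (X * r), ← h3, aeval_X]
        simp only [mul_add, add_mul, mul_smul_comm, smul_mul_assoc, mul_assoc]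
        simp
      · rw [mul_add, map_add, ← h2, ex, mul_smul_comm, pow_two, mul_assoc X X s, map_smul,
          map_mul _ X (X * s), ← h4, aeval_X]
        simp only [mul_add, add_mul, mul_smul_comm, smul_mul_assoc, mul_assoc]
        simp
      · rw [← h3, ex, mul_add, mul_smul_comm, ← mul_assoc a a, ha]
        simp
      · rw [← h4, ex, mul_add, mul_smul_comm, ← mul_assoc a a, ha]
        simp
    · change x = (β ^ m) ^ k * x' at hx
      change M = lowerUnipotent (m * l) ^ k * M' at hM
      have ex := val_pow_zpow_mul hb hβ m k x'
      rw [← hx] at ex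
      refine ⟨p, q, r + (m * k : ℤ) • (X * p), s + (m * k : ℤ) • (X * q), ?_, ?_, ?_, ?_, ?_⟩
      · rw [hM, lowerUnipotent_zpow]
        change !![1, 0; (k : ℂ) * (m * l), 1] * M'.1 = _
        rw [h0]
        ext i j
        fin_cases i <;> fin_cases j <;> simp <;> ring
      · rw [← h1, ex, mul_add, mul_smul_comm, mul_assoc a b (b * _), ← mul_assoc b b, hb]
        simp
      · rw [← h2, ex, mul_add, mul_smul_comm, mul_assoc a b (b * _), ← mul_assoc b b, hb]
        simp
      · rw [mul_add, map_add, ← h3, ex, mul_smul_comm, map_smul, ← mul_assoc X X p, ← pow_two, ← h1]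
        simp only [mul_add, add_mul, mul_smul_comm, smul_mul_assoc, mul_assoc]
      · rw [mul_add, map_add, ← h4, ex, mul_smul_comm, map_smul, ← mul_assoc X X q, ← pow_two, ← h2]
        simp only [mul_add, add_mul, mul_smul_comm, smul_mul_assoc, mul_assoc]

theorem exists_isFreePair_of_aeval (ha : a * a = 0) (hb : b * b = 0) (hα : (α : R) = 1 + a)
    (hβ : (β : R) = 1 + b) {l : ℂ} (hl : l ≠ 0)
    (h : ∀ p : ℤ[X], aeval (a * b) p = 0 → aeval l p = 0) :
    ∃ m : ℕ, 0 < m ∧ IsFreePair α (β ^ m) := by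
  obtain ⟨m, hm⟩ := exists_nat_ge (4 / ‖l‖)
  have hl' : 0 < ‖l‖ := norm_pos_iff.mpr hl
  have hfree : IsFreePair (upperUnipotent 1) (lowerUnipotent (m * l)) := by
    refine isFreePair_upperUnipotent_lowerUnipotent ?_
    rw [norm_mul, Complex.norm_natCast]
    exact (div_le_iff₀ hl').mp hm
  refine ⟨m, ?_, ?_⟩
  · have : (0 : ℝ) < m := lt_of_lt_of_le (by positivity) hm
    exact_mod_cast this
  · refine (injective_iff_map_eq_one _).mpr fun w hw => ?_
    obtain ⟨p, q, r, s, h0, h1, h2, h3, h4⟩ := exists_entries_aeval ha hb hα hβ m l w _ _ rfl rfl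
    refine (injective_iff_map_eq_one _).mp hfree w ?_
    rw [hw, Units.val_one, mul_one] at h1 h2 h3 h4
    -- At `x = 1` the left sides are known, so each relation is an integral polynomial killing `ab`;
    -- at `l ≠ 0` the extra powers of `X` cancel.
    have e1 := h (X ^ 2 * p - X ^ 2) (by
      rw [map_sub, ← h1, map_pow, aeval_X, pow_two, mul_assoc, sub_self])
    have e2 := h (X ^ 2 * q) (by rw [← h2, mul_assoc, hb, mul_zero])
    have e3 := h (X * r) (by rw [← h3, ha, zero_mul])
    have e4 := h (X * s - X) (by rw [map_sub, ← h4, aeval_X, sub_self])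
    simp only [map_sub, map_mul, map_pow, aeval_X] at e1 e2 e3 e4
    refine Subtype.ext (h0.trans ?_)
    have f1 : aeval l p = 1 := mul_left_cancel₀ (pow_ne_zero 2 hl) (by linear_combination e1)
    have f2 : aeval l q = 0 := by simpa [hl] using e2
    have f3 : aeval l r = 0 := by simpa [hl] using e3
    have f4 : aeval l s = 1 := mul_left_cancel₀ hl (by linear_combination e4)
    rw [f1, f2, f3, f4]
    exact Matrix.one_fin_two.symm

theorem isNilpotent_of_minpoly_roots {A : Type*} [Ring A] [Algebra ℂ A] {x : A}
    (hx : IsIntegral ℂ x) (h : ∀ l : ℂ, (minpoly ℂ x).IsRoot l → l = 0) : IsNilpotent x := by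
  have hs := (IsAlgClosed.splits (minpoly ℂ x)).eq_prod_roots_of_monic (minpoly.monic hx)
  have hr : (minpoly ℂ x).roots = Multiset.replicate (minpoly ℂ x).roots.card 0 :=
    Multiset.eq_replicate_card.mpr fun l hl => h l (isRoot_of_mem_roots hl)
  rw [hr] at hs
  have h0 := minpoly.aeval ℂ x
  rw [hs] at h0
  exact ⟨_, by simpa using h0⟩

theorem exists_isFreePair_of_not_isNilpotent {A : Type*} [Ring A] [Algebra ℂ A] (f : R →+* A)
    (hf : Function.Injective f) (ha : a * a = 0) (hb : b * b = 0) (hα : (α : R) = 1 + a)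
    (hβ : (β : R) = 1 + b) (h : ¬ IsNilpotent (a * b)) :
    ∃ m : ℕ, 0 < m ∧ IsFreePair α (β ^ m) := by
  have heval : ∀ p : ℤ[X], aeval (a * b) p = 0 →
      aeval (f (a * b)) (p.map (algebraMap ℤ ℂ)) = 0 := by
    intro p hp
    have := congrArg f hp
    rw [map_zero] at this
    rw [aeval_map_algebraMap, ← this]
    exact aeval_algHom_apply f.toIntAlgHom (a * b) p
  by_cases halg : IsAlgebraic ℂ (f (a * b))
  · have hex : ∃ l : ℂ, (minpoly ℂ (f (a * b))).IsRoot l ∧ l ≠ 0 := by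
      by_contra! hno
      have := isNilpotent_of_minpoly_roots halg.isIntegral hno
      exact h ((IsNilpotent.map_iff hf).mp this)
    obtain ⟨l, hl, hl0⟩ := hex
    refine exists_isFreePair_of_aeval ha hb hα hβ hl0 fun p hp => ?_
    have := (hl.dvd (minpoly.dvd ℂ _ (heval p hp)))
    rwa [IsRoot, eval_map_algebraMap] at this
  -- A transcendental `ab` is killed only by the zero polynomial, so any nonzero `l` serves.
  · refine exists_isFreePair_of_aeval ha hb hα hβ one_ne_zero fun p hp => ?_
    have : p.map (algebraMap ℤ ℂ) = 0 := by
      by_contra hne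
      exact halg ⟨_, hne, heval p hp⟩
    rw [(Polynomial.map_eq_zero_iff (RingHom.injective_int _)).mp this, map_zero]

end Specialization

/-! ### The nilpotent case -/

section Nilpotent

variable {R : Type*} [Ring R]

/-- The additive span of the products of at least `n` factors from `{a, b}`. -/
def wordFiltration (a b : R) (n : ℕ) : Submodule ℤ R :=
  Submodule.span ℤ {x | ∃ l : List R, (∀ y ∈ l, y = a ∨ y = b) ∧ n ≤ l.length ∧ l.prod = x}

variable {a b : R}

theorem wordFiltration_antitone : Antitone (wordFiltration a b) := by
  intro m n hmn
  refine Submodule.span_mono ?_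
  rintro x ⟨l, hl, hn, hx⟩
  exact ⟨l, hl, hmn.trans hn, hx⟩

theorem one_mem_wordFiltration : (1 : R) ∈ wordFiltration a b 0 :=
  Submodule.subset_span ⟨[], by simp⟩

theorem mul_mem_wordFiltration {m n : ℕ} {x y : R} (hx : x ∈ wordFiltration a b m)
    (hy : y ∈ wordFiltration a b n) : x * y ∈ wordFiltration a b (m + n) := by
  have h := Submodule.mul_mem_mul hx hy
  rw [wordFiltration, wordFiltration, Submodule.span_mul_span] at h
  refine Submodule.span_mono ?_ h
  rintro _ ⟨_, ⟨l, hl, hm, rfl⟩, _, ⟨l', hl', hn, rfl⟩, rfl⟩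
  refine ⟨l ++ l', ?_, ?_, List.prod_append⟩
  · intro y hy
    rcases List.mem_append.mp hy with hy | hy
    exacts [hl y hy, hl' y hy]
  · rw [List.length_append]
    exact add_le_add hm hn

theorem mul_pow_succ_comm (a b : R) (k : ℕ) : (b * a) ^ (k + 1) = b * (a * b) ^ k * a := by
  induction k with
  | zero => simp
  | succ k ih => rw [pow_succ, ih, pow_succ (a * b)]; simp only [mul_assoc]

theorem list_prod_eq_of_length (ha : a * a = 0) (hb : b * b = 0) (j : ℕ) (l : List R)
    (hl : ∀ y ∈ l, y = a ∨ y = b) (hj : l.length = 2 * j) :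
    l.prod = 0 ∨ l.prod = (a * b) ^ j ∨ l.prod = (b * a) ^ j := by
  induction j generalizing l with
  | zero =>
    have h0 : l = [] := List.length_eq_zero_iff.mp (by simpa using hj)
    simp [h0]
  | succ j ih =>
    match l, hl, hj with
    | x :: y :: l, hl, hj =>
      have hx := hl x (by simp)
      have hy := hl y (by simp)
      have h := ih l (fun z hz => hl z (by simp [hz])) (by simp at hj; lia)
      simp only [List.prod_cons, ← mul_assoc]
      have e1 : a * b * (b * a) ^ j = 0 ∨ a * b * (b * a) ^ j = (a * b) ^ (j + 1) := by
        cases j with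
        | zero => simp
        | succ j => left; rw [pow_succ', ← mul_assoc, ← mul_assoc, mul_assoc a b b, hb]; simp
      have e2 : b * a * (a * b) ^ j = 0 ∨ b * a * (a * b) ^ j = (b * a) ^ (j + 1) := by
        cases j with
        | zero => simp
        | succ j => left; rw [pow_succ', ← mul_assoc, ← mul_assoc, mul_assoc b a a, ha]; simp
      rcases hx with hx | hx <;> rcases hy with hy | hy <;> rw [hx, hy]
      · simp [ha]
      · rcases h with h | h | h <;> rw [h]
        · simp
        · simp [pow_succ']
        · exact e1.imp_right Or.inl
      · rcases h with h | h | h <;> rw [h]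
        · simp
        · exact e2.imp_right Or.inr
        · simp [pow_succ']
      · simp [hb]

/-- The extra `1` accounts for words starting with `b`: `(ba) ^ (k + 1) = b (ab) ^ k a`. -/
theorem wordFiltration_eq_bot (ha : a * a = 0) (hb : b * b = 0) {k : ℕ} (hk : (a * b) ^ k = 0) :
    wordFiltration a b (2 * (k + 1)) = ⊥ := by
  rw [wordFiltration, Submodule.span_eq_bot]
  rintro _ ⟨l, hl, hn, rfl⟩
  rw [← List.take_append_drop (2 * (k + 1)) l, List.prod_append]
  have := list_prod_eq_of_length ha hb (k + 1) (l.take (2 * (k + 1)))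
    (fun y hy => hl y (List.mem_of_mem_take hy)) (by simpa using hn)
  rw [mul_pow_succ_comm a b, pow_succ, hk] at this
  simp only [zero_mul, mul_zero, or_self] at this
  rw [this, zero_mul]

variable {α β : Rˣ}

theorem sub_one_mem_wordFiltration (ha : a * a = 0) (hb : b * b = 0) (hα : (α : R) = 1 + a)
    (hβ : (β : R) = 1 + b) {g : Rˣ} (hg : g ∈ Subgroup.closure ({α, β} : Set Rˣ)) :
    (g : R) - 1 ∈ wordFiltration a b 1 := by
  have ha1 : a ∈ wordFiltration a b 1 := Submodule.subset_span ⟨[a], by simp⟩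
  have hb1 : b ∈ wordFiltration a b 1 := Submodule.subset_span ⟨[b], by simp⟩
  have key : ∀ {c : R} {γ : Rˣ}, c ∈ wordFiltration a b 1 → c * c = 0 → (γ : R) = 1 + c →
      ∀ (k : ℤ) (y : Rˣ), (y : R) - 1 ∈ wordFiltration a b 1 →
        ((γ ^ k * y : Rˣ) : R) - 1 ∈ wordFiltration a b 1 := by
    intro c γ hc hcc hγ k y hy
    have h := mul_mem_wordFiltration hc hy
    rw [Units.val_mul, val_zpow_of_sq_eq_zero hcc hγ]
    have e : (1 + k • c) * (y : R) - 1 = (y - 1) + k • c + k • (c * (y - 1)) := by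
      rw [add_mul, mul_sub, smul_mul_assoc, smul_sub, mul_one, one_mul]
      abel
    rw [e]
    exact add_mem (add_mem hy (Submodule.smul_mem _ _ hc))
      (Submodule.smul_mem _ _ (wordFiltration_antitone (by norm_num) h))
  induction hg using Subgroup.closure_induction_left with
  | one => simp
  | mul_left x hx y _ h =>
    rcases hx with rfl | rfl
    · simpa using key ha1 ha hα 1 y h
    · simpa using key hb1 hb hβ 1 y h
  | inv_mul_cancel x hx y _ h =>
    rcases hx with rfl | rfl
    · simpa using key ha1 ha hα (-1) y h
    · simpa using key hb1 hb hβ (-1) y h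

theorem isNilpotent_closure_of_isNilpotent (ha : a * a = 0) (hb : b * b = 0)
    (hα : (α : R) = 1 + a) (hβ : (β : R) = 1 + b) (h : IsNilpotent (a * b)) :
    Group.IsNilpotent (Subgroup.closure ({α, β} : Set Rˣ)) := by
  obtain ⟨k, hk⟩ := h
  have h1 : ∀ g : Subgroup.closure ({α, β} : Set Rˣ), ((g : Rˣ) : R) - 1 ∈ wordFiltration a b 1 :=
    fun g => sub_one_mem_wordFiltration ha hb hα hβ g.2
  have h0 : ∀ g : Subgroup.closure ({α, β} : Set Rˣ), ((g : Rˣ) : R) ∈ wordFiltration a b 0 :=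
    fun g => by
      simpa using add_mem (wordFiltration_antitone (Nat.zero_le 1) (h1 g))
        (one_mem_wordFiltration (a := a) (b := b))
  -- Congruence subgroups modulo the word filtration.
  let H : ℕ → Subgroup (Subgroup.closure ({α, β} : Set Rˣ)) := fun n =>
    { carrier := {g | ((g : Rˣ) : R) - 1 ∈ wordFiltration a b n}
      one_mem' := by simp
      mul_mem' := by
        intro x y hx hy
        have h := add_mem (mul_mem_wordFiltration hx (h0 y)) hy
        rw [sub_mul, one_mul, sub_add_sub_cancel] at h
        simpa using h
      inv_mem' := by
        intro x hx
        have h := neg_mem (mul_mem_wordFiltration hx (h0 x⁻¹))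
        simpa [sub_mul] using h }
  refine (Subgroup.nilpotent_iff_finite_descending_central_series _).mpr
    ⟨2 * (k + 1), H, ⟨?_, ?_⟩, ?_⟩
  · refine eq_top_iff.mpr fun g _ => ?_
    exact wordFiltration_antitone (Nat.zero_le 1) (h1 g)
  · intro x n hx g
    change (((⁅x, g⁆ : Subgroup.closure ({α, β} : Set Rˣ)) : Rˣ) : R) - 1 ∈ wordFiltration a b (n + 1)
    -- From `⁅x, g⁆ - 1 = ((x - 1)(g - 1) - (g - 1)(x - 1))(gx)⁻¹`: each product gains one letter.
    have hc := mul_mem_wordFiltration (sub_mem (mul_mem_wordFiltration hx (h1 g))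
      (add_comm 1 n ▸ mul_mem_wordFiltration (h1 g) hx)) (h0 (g * x)⁻¹)
    convert hc using 1
    have e : (((x * g : Subgroup.closure ({α, β} : Set Rˣ)) : Rˣ) : R) -
        ((g * x : Subgroup.closure ({α, β} : Set Rˣ)) : Rˣ) =
        ((x : Rˣ) - 1 : R) * ((g : Rˣ) - 1) - ((g : Rˣ) - 1) * ((x : Rˣ) - 1) := by
      push_cast
      noncomm_ring
    rw [← e, sub_mul, ← Units.val_mul, ← Units.val_mul, ← Subgroup.coe_mul, ← Subgroup.coe_mul,
      mul_inv_cancel, commutatorElement_def, mul_inv_rev]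
    simp [mul_assoc]
  · refine eq_bot_iff.mpr fun g hg => ?_
    have hg' : ((g : Rˣ) : R) - 1 ∈ wordFiltration a b (2 * (k + 1)) := hg
    rw [wordFiltration_eq_bot ha hb hk, Submodule.mem_bot, sub_eq_zero] at hg'
    exact Subgroup.mem_bot.mpr (Subtype.ext (Units.ext hg'))

end Nilpotent

/-! ### Eigenvalues of algebraic elements -/

theorem isEigenvalueOf_iff {A : Type*} [Ring A] [Algebra ℂ A] {x : A} {l : ℂ} :
    IsEigenvalueOf x l ↔ ∃ y, y ≠ 0 ∧ x * y = l • y := by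
  constructor
  · intro h
    obtain ⟨y, hy⟩ := Module.End.HasEigenvalue.exists_hasEigenvector h
    exact ⟨y, hy.2, hy.apply_eq_smul⟩
  · rintro ⟨y, hy, h⟩
    exact Module.End.hasEigenvalue_of_hasEigenvector (x := y)
      ⟨Module.End.mem_eigenspace_iff.mpr h, hy⟩

open Polynomial in
-- Writing the minimal polynomial as `(X - l) q`, the element `q(x)` is an eigenvector, nonzero by
-- minimality.
theorem isEigenvalueOf_of_isRoot {A : Type*} [Ring A] [Algebra ℂ A] {x : A} {l : ℂ}
    (hx : IsIntegral ℂ x) (hl : (minpoly ℂ x).IsRoot l) : IsEigenvalueOf x l := by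
  obtain ⟨q, hq⟩ := dvd_iff_isRoot.mpr hl
  refine isEigenvalueOf_iff.mpr ⟨aeval x q, fun h0 => ?_, ?_⟩
  · have hne := minpoly.ne_zero hx
    have hq0 : q ≠ 0 := by
      rintro rfl
      exact hne (by simpa using hq)
    have hdeg := minpoly.degree_le_of_ne_zero ℂ x hq0 h0
    rw [hq, degree_mul, degree_X_sub_C, degree_eq_natDegree hq0] at hdeg
    norm_cast at hdeg
    lia
  · have h := minpoly.aeval ℂ x
    rw [hq, map_mul, map_sub, aeval_X, aeval_C, sub_mul, sub_eq_zero] at h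
    rw [h, Algebra.smul_def]

theorem isNilpotent_iff_zeroIsOnlyEigenvalue {A : Type*} [Ring A] [Algebra ℂ A] [Nontrivial A]
    {x : A} (hx : IsAlgebraic ℂ x) : IsNilpotent x ↔ ZeroIsOnlyEigenvalue x := by
  constructor
  · intro h l
    rw [isEigenvalueOf_iff]
    constructor
    · rintro ⟨y, hy, hxy⟩
      obtain ⟨k, hk⟩ := h
      have hpow : ∀ n : ℕ, x ^ n * y = l ^ n • y := by
        intro n
        induction n with
        | zero => simp
        | succ n ih => rw [pow_succ, mul_assoc, hxy, mul_smul_comm, ih, smul_smul, pow_succ']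
      have := hpow k
      rw [hk, zero_mul] at this
      exact eq_zero_of_pow_eq_zero ((smul_eq_zero.mp this.symm).resolve_right hy)
    · rintro rfl
      -- The last nonzero power of `x` is an eigenvector for `0`.
      have h0 := pow_nilpotencyClass h
      have h1 := pow_pred_nilpotencyClass h
      refine ⟨_, h1, ?_⟩
      rw [← pow_succ', Nat.sub_add_cancel (pos_nilpotencyClass_iff.mpr h), h0, zero_smul]
  · intro h
    exact isNilpotent_of_minpoly_roots hx.isIntegral fun l hl =>
      (h l).mp (isEigenvalueOf_of_isRoot hx.isIntegral hl)

theorem mainTheorem7 {R : Type*} [Ring R] [CharZero R] [IsAddTorsionFree R]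
    (a b : R) (ha : a ^ 2 = 0) (hb : b ^ 2 = 0)
    (α β : Rˣ) (hα : (α : R) = 1 + a) (hβ : (β : R) = 1 + b) :
    (∀ m n : ℕ, 0 < m → 0 < n →
      (IsFreePair (α ^ m) (β ^ n) ↔ IsFreePair α (β ^ (m * n)))) ∧
    (¬ IsNilpotent (a * b) → ∃ m : ℕ, 0 < m ∧ IsFreePair α (β ^ m)) ∧
    (IsNilpotent (a * b) ↔ Group.IsNilpotent (Subgroup.closure ({α, β} : Set Rˣ))) ∧
    (IsAlgebraic ℂ (complexify (a * b)) →
      (Group.IsNilpotent (Subgroup.closure ({α, β} : Set Rˣ)) ↔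
        ZeroIsOnlyEigenvalue (complexify (a * b)))) ∧
    (∀ (A : Type*) [Ring A] [Algebra ℂ A] (f : R →+* A), Function.Injective f →
      IsAlgebraic ℂ (f (a * b)) →
      (Group.IsNilpotent (Subgroup.closure ({α, β} : Set Rˣ)) ↔
        ZeroIsOnlyEigenvalue (f (a * b)))) := by
  rw [pow_two] at ha hb
  let ι : R →+* ℂ ⊗[ℤ] R := (Algebra.TensorProduct.includeRight : R →ₐ[ℤ] ℂ ⊗[ℤ] R).toRingHom
  -- Torsion-free means flat over `ℤ`, so the inclusion of `ℤ` in `ℂ` stays injective after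
  -- tensoring with `R`.
  have hι : Function.Injective ι :=
    Algebra.TensorProduct.includeRight_injective (RingHom.injective_int (algebraMap ℤ ℂ))
  have hfree := exists_isFreePair_of_not_isNilpotent ι hι ha hb hα hβ
  have hnil : IsNilpotent (a * b) ↔ Group.IsNilpotent (Subgroup.closure ({α, β} : Set Rˣ)) := by
    refine ⟨isNilpotent_closure_of_isNilpotent ha hb hα hβ, fun h => ?_⟩
    by_contra hn
    obtain ⟨m, -, hm⟩ := hfree hn
    exact hm.not_isNilpotent (Subgroup.subset_closure (by simp))
      (pow_mem (Subgroup.subset_closure (by simp)) m) h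
  refine ⟨fun m n hm _ => isFreePair_pow_pow_iff ha hb hα hβ hm, hfree, hnil, ?_, ?_⟩
  · intro halg
    have : Nontrivial (ℂ ⊗[ℤ] R) := hι.nontrivial
    rw [← hnil, ← isNilpotent_iff_zeroIsOnlyEigenvalue halg]
    exact (IsNilpotent.map_iff hι).symm
  · intro A _ _ f hf halg
    have : Nontrivial A := hf.nontrivial
    rw [← hnil, ← isNilpotent_iff_zeroIsOnlyEigenvalue halg, IsNilpotent.map_iff hf]
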